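/- For each $n\ge 1$ let $(d_i)_{i=1}^n=(d_i^{(n)})_{i=1}^n$ be a sequence of non-negative integers with even sum. Let $G^*=G^*(n,(d_i)_1^n)$ be the random multigraph on $\{1,\dots,n\}$ given by the configuration model: vertex $i$ carries $d_i$ half-edges, and the set of all half-edges is paired up by a uniformly random perfect matching, each pair forming an edge between the vertices carrying its two half-edges (loops and multiple edges are allowed). Given $G^*$, consider the vertices one by one in a uniformly random order independent of $G^*$; starting from $\mathcal S=\emptyset$, add the vertex under consideration to $\mathcal S$ if it is not adjacent to any vertex already in $\mathcal S$, and otherwise do nothing (a vertex with a loop may be added). Let $S_\infty=S_\infty^{(n)}$ be the final size of $\mathcal S$. Let $n_k=n_k(n)=\#\{i: d_i=k\}$, let $\lambda_n=\sum_k k\,n_k/n$ be the average degree, and let $r(n)$ be the number of vertices $i$ with $d_i\le \min(\lambda_n^{1/8},n^{1/6})$. Suppose that $\lambda_n\to\infty$ as $n\to\infty$. Then for every $\delta>0$, $$\mathbb P\bigl(S_\infty^{(n)}\ge (1-\delta)\,r(n)\bigr)\to 1\qquad\text{as } n\to\infty .$$ -/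

import Mathlib

open Filter Topology ProbabilityTheory

noncomputable section

open scoped Classical in
/-- One pass of the greedy algorithm over a list of vertices, starting from the set `S`: each vertex
in turn is added to the current set unless it is adjacent to a vertex already there.
A vertex with a loop is eligible: only adjacency to a vertex already chosen matters. -/
def greedyFrom {V β : Type*} (G : Graph V β) (S : Finset V) (l : List V) : Finset V :=
  l.foldl (fun S v => if ∃ w ∈ S, G.Adj v w then S else insert v S) S

/-- The greedy independent set of `G` when the vertices are considered in the order
`π 0, π 1, …, π (n - 1)`. -/
def greedyIndepSet {n : ℕ} {β : Type*} (G : Graph (Fin n) β) (π : Equiv.Perm (Fin n)) :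
    Finset (Fin n) :=
  greedyFrom G ∅ (List.ofFn π)

/-- The half-edges of a degree sequence `d`: vertex `i` carries `d i` of them. -/
abbrev HalfEdge {n : ℕ} (d : Fin n → ℕ) : Type := Σ i : Fin n, Fin (d i)

/-- The perfect matchings of the set of half-edges, as fixed-point-free involutions
(`σ h` is the half-edge paired with `h`). -/
abbrev Pairing {n : ℕ} (d : Fin n → ℕ) : Type :=
  {σ : Equiv.Perm (HalfEdge d) // Function.Involutive σ ∧ ∀ h, σ h ≠ h}

/-- The multigraph obtained from a pairing: the edges are the pairs `{h, σ h}` of matched half-edges,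
and such an edge joins the vertices that carry `h` and `σ h`. -/
def Pairing.multigraph {n : ℕ} {d : Fin n → ℕ} (σ : Pairing d) :
    Graph (Fin n) (Sym2 (HalfEdge d)) where
  vertexSet := Set.univ
  IsLink e v w := ∃ h : HalfEdge d, e = s(h, σ.1 h) ∧ h.1 = v ∧ (σ.1 h).1 = w
  isLink_symm := by
    rintro e -
    refine ⟨?_⟩
    rintro v w ⟨h, rfl, rfl, rfl⟩
    exact ⟨σ.1 h, by rw [σ.2.1 h, Sym2.eq_swap], rfl, by rw [σ.2.1 h]⟩
  eq_or_eq_of_isLink_of_isLink := by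
    rintro e v w v' w' ⟨h, rfl, rfl, rfl⟩ ⟨h', he, rfl, rfl⟩
    rcases Sym2.eq_iff.1 he with ⟨h1, -⟩ | ⟨h1, -⟩
    · exact Or.inl (by rw [h1])
    · exact Or.inr (by rw [h1])
  left_mem_of_isLink := fun _ _ _ _ => Set.mem_univ _

theorem Pairing.multigraph_adj {n : ℕ} {d : Fin n → ℕ} (σ : Pairing d) (v w : Fin n) :
    σ.multigraph.Adj v w ↔ ∃ h : HalfEdge d, h.1 = v ∧ (σ.1 h).1 = w := by
  constructor
  · rintro ⟨e, h, -, hv, hw⟩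
    exact ⟨h, hv, hw⟩
  · rintro ⟨h, hv, hw⟩
    exact ⟨s(h, σ.1 h), h, rfl, hv, hw⟩

/-- The finite sample space: a perfect matching of the half-edges together with an order of the
vertices. -/
def Outcome {n : ℕ} (d : Fin n → ℕ) : Type := Pairing d × Equiv.Perm (Fin n)

instance {n : ℕ} (d : Fin n → ℕ) : MeasurableSpace (Outcome d) := ⊤

/-- The uniform law on the sample space. Under it the pairing (hence the configuration-model random
multigraph) and the order of the vertices are uniform, and independent of each other. -/
def outcomeLaw {n : ℕ} (d : Fin n → ℕ) : MeasureTheory.Measure (Outcome d) :=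
  uniformOn (Set.univ : Set (Outcome d))

/-- The size of the greedy independent set in the random multigraph. -/
def greedySize {n : ℕ} (d : Fin n → ℕ) (ω : Outcome d) : ℕ :=
  (greedyIndepSet (Pairing.multigraph ω.1) ω.2).card

/-- The number of vertices of degree `k`. -/
def degreeCount {n : ℕ} (d : Fin n → ℕ) (k : ℕ) : ℕ :=
  (Finset.univ.filter fun i => d i = k).card

/-- The average degree `∑ₖ k nₖ / n` (the sum runs over the degrees that occur). -/
def avgDegree {n : ℕ} (d : Fin n → ℕ) : ℝ :=
  ∑ k ∈ Finset.univ.image d, (k : ℝ) * degreeCount d k / n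

theorem avgDegree_eq {n : ℕ} (d : Fin n → ℕ) : avgDegree d = (∑ i, (d i : ℝ)) / n := by
  rw [avgDegree, ← Finset.sum_div, Finset.sum_comp (fun k : ℕ => (k : ℝ)) d]
  simp [degreeCount, mul_comm]

/-- The number of vertices of degree at most `min (λ ^ (1/8)) (n ^ (1/6))`, with `λ` the average
degree. -/
def lowDegreeCount {n : ℕ} (d : Fin n → ℕ) : ℕ :=
  (Finset.univ.filter fun i =>
    (d i : ℝ) ≤ min (avgDegree d ^ (1 / 8 : ℝ)) ((n : ℝ) ^ (1 / 6 : ℝ))).card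

end

/-!
The proof shows that, with high probability, the selected vertices carry only a tiny proportion of
all half-edges, so that a vertex of low degree is unlikely to be joined to any of them. Write `S`
for the selected set, `Y` for the sum of the degrees over `S`, `Y_v` for the same sum over the
vertices selected before `v`, `M` for the number of half-edges and `λ = M / n`. Everything is
done by counting outcomes, and the order of the vertices is held fixed in the two main estimates;
these compare pairings by switchings, that is by exchanging the partners of two half-edges.

* If `v` is selected, switching one of its half-edges into an edge leaving a vertex selected
  earlier yields a pairing in which that vertex is the first to block `v`. As the first blocker is
  unique, `E [1_{v ∈ S} d_v Y_v] ≤ 2 M` (`sum_chosenBefore_le`). Summed over `v`, this bounds the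
  off-diagonal part of `E [Y ^ 2]` by `4 n M = 4 M ^ 2 / λ`.
* The diagonal part is the sum of `d_v ^ 2 P (v ∈ S)`. Each vertex of positive degree
  considered before `v` is an end of an edge at a vertex selected before `v`, so `Y_v` is at least
  half of the rank of `v` among the vertices of positive degree (`rankPos_le`). The previous
  estimate then makes selection at rank at least `T` unlikely, and rank below `T` is unlikely in a
  uniform order (`card_perm_rankPos_lt_mul_le`). With `k` vertices of positive degree this
  gives `E [Y ^ 2] ≤ M ^ 2 (4 / λ + T / k + 4 / T)` (`sum_sq_chosenDegree_le`).
* Conversely, if `i` is blocked while `Y ≤ M / 4`, an edge from `i` to `S` can be switched away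
  with at least `M / 2` half-edges without changing the process up to the end of that edge. So the
  probability of this event is at most `2 d_i E [Y] / M` (`card_not_mem_chosen_mul_le`).

Markov's inequality (`card_chosen_lt_le`) combines these for the vertices of low degree. If the
isolated vertices, which are always selected, are not enough for the claim, then `k ≥ δ n`; with
`T` of order `√n` the error terms tend to `0`, because the square of the degree bound is at most
`λ ^ (1/4)` and at most `n ^ (1/3)`.
-/

/-! ### The greedy algorithm -/

open scoped Classical in
theorem greedyFrom_append_singleton {V β : Type*} (G : Graph V β) (S : Finset V) (l : List V)
    (x : V) :
    greedyFrom G S (l ++ [x]) =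
      if ∃ w ∈ greedyFrom G S l, G.Adj x w then greedyFrom G S l
      else insert x (greedyFrom G S l) := by
  unfold greedyFrom
  simp only [List.foldl_append, List.foldl_cons, List.foldl_nil]

/-- If `r` is the order in which `l` lists the vertices, `v` is selected if and only if no vertex
selected earlier is adjacent to `v`. By recursion along `r` this determines the greedy set. -/
theorem mem_greedyFrom_iff {V β : Type*} (G : Graph V β) (r : V → V → Prop)
    (hr : ∀ a b, r a b → ¬ r b a) (l : List V) (hl : l.Pairwise r) (v : V) :
    v ∈ greedyFrom G ∅ l ↔ v ∈ l ∧ ∀ w ∈ greedyFrom G ∅ l, r w v → ¬ G.Adj v w := by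
  classical
  induction l using List.reverseRecOn generalizing v with
  | nil => simp [greedyFrom]
  | append_singleton l x ih =>
    rw [List.pairwise_append] at hl
    obtain ⟨h1, -, h2⟩ := hl
    have hx : ∀ a ∈ l, r a x := fun a ha => h2 a ha x (by simp)
    have ih := ih h1
    have hsub : ∀ w ∈ greedyFrom G ∅ l, w ∈ l := fun w hw => ((ih w).1 hw).1
    have hxl : x ∉ l := fun h => hr x x (hx x h) (hx x h)
    have hxx : ¬ r x x := fun h => hr x x h h
    rw [greedyFrom_append_singleton]
    by_cases hv : v ∈ l
    · have hvx : v ≠ x := fun h => hxl (h ▸ hv)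
      have hrv : ¬ r x v := hr _ _ (hx v hv)
      split_ifs with hadj
      · rw [ih]; simp [hv]
      · simp [hvx, ih v, hv, hrv]
    · by_cases hvx : v = x
      · subst hvx
        have : v ∉ greedyFrom G ∅ l := fun h => hv (hsub v h)
        split_ifs with hadj
        · obtain ⟨w, hw, hvw⟩ := hadj
          simp only [this, false_iff, not_and, not_forall, not_not]
          exact fun _ => ⟨w, hw, hx w (hsub w hw), hvw⟩
        · push Not at hadj
          simp only [Finset.mem_insert, true_or, List.mem_append, List.mem_singleton, or_true,
            true_and, true_iff, forall_eq_or_imp]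
          exact ⟨fun h => absurd h hxx, fun w hw _ => hadj w hw⟩
      · have : v ∉ greedyFrom G ∅ l := fun h => hv (hsub v h)
        split_ifs with hadj <;> simp [this, hvx, hv]

variable {n : ℕ} {d : Fin n → ℕ}

/-- The set selected by the greedy algorithm in the multigraph of `σ`, in the order `π`. -/
noncomputable abbrev chosen (σ : Pairing d) (π : Equiv.Perm (Fin n)) : Finset (Fin n) :=
  greedyIndepSet σ.multigraph π

theorem mem_chosen_iff (σ : Pairing d) (π : Equiv.Perm (Fin n)) (v : Fin n) :
    v ∈ chosen σ π ↔ ∀ h : HalfEdge d, h.1 ∈ chosen σ π → π.symm h.1 < π.symm v →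
      (σ.1 h).1 ≠ v := by
  unfold chosen greedyIndepSet
  rw [mem_greedyFrom_iff σ.multigraph (fun a b => π.symm a < π.symm b)
    (fun a b h => not_lt.2 h.le) (List.ofFn π)
    (by rw [List.pairwise_ofFn]; intro i j hij; simpa using hij)]
  simp only [List.mem_ofFn, π.surjective v, true_and]
  constructor
  · intro H h hh hlt heq
    exact H _ hh hlt ((σ.multigraph_adj _ _).2 ⟨σ.1 h, heq, by rw [σ.2.1 h]⟩)
  · intro H w hw hlt hadj
    obtain ⟨h, rfl, rfl⟩ := (σ.multigraph_adj _ _).1 hadj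
    exact H (σ.1 h) hw hlt (by rw [σ.2.1 h])

/-- The greedy algorithm up to and including `v` only looks at the half-edges of the vertices
selected before `v`. -/
theorem mem_chosen_congr {σ σ' : Pairing d} {π : Equiv.Perm (Fin n)} {v : Fin n}
    (H : ∀ h : HalfEdge d, h.1 ∈ chosen σ π → π.symm h.1 < π.symm v → σ'.1 h = σ.1 h)
    (x : Fin n) (hx : π.symm x ≤ π.symm v) : x ∈ chosen σ' π ↔ x ∈ chosen σ π := by
  induction hk : π.symm x using WellFoundedLT.induction generalizing x with
  | ind k ih =>
    subst hk
    rw [mem_chosen_iff, mem_chosen_iff]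
    refine forall_congr' fun h => ?_
    constructor
    · intro h1 h2 h3
      rw [← H h h2 (h3.trans_le hx)]
      exact h1 ((ih _ h3 _ (h3.le.trans hx) rfl).2 h2) h3
    · intro h1 h2 h3
      have h2' := (ih _ h3 _ (h3.le.trans hx) rfl).1 h2
      rw [H h h2' (h3.trans_le hx)]
      exact h1 h2' h3

/-! ### Switchings -/

/-- The pairing in which the half-edges `b` and `c` have exchanged their partners. It is the
conjugate of `σ` by the transposition of `b` and `c`, hence equal to `σ` if `b` and `c` are
themselves partners. -/
def Pairing.switch (σ : Pairing d) (b c : HalfEdge d) : Pairing d :=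
  ⟨Equiv.swap b c * σ.1 * Equiv.swap b c, by
    intro h
    simp only [Equiv.Perm.coe_mul, Function.comp_apply, Equiv.swap_apply_self, σ.2.1 _], by
    intro h hh
    simp only [Equiv.Perm.coe_mul, Function.comp_apply] at hh
    rw [← Equiv.eq_symm_apply, Equiv.symm_swap] at hh
    exact σ.2.2 _ hh⟩

theorem Pairing.switch_apply (σ : Pairing d) (b c h : HalfEdge d) :
    (σ.switch b c).1 h = Equiv.swap b c (σ.1 (Equiv.swap b c h)) := rfl

theorem Pairing.switch_switch (σ : Pairing d) (b c : HalfEdge d) :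
    (σ.switch b c).switch b c = σ := by
  apply Subtype.ext
  ext1 h
  simp only [Pairing.switch_apply, Equiv.swap_apply_self]

theorem Pairing.switch_apply_of_ne (σ : Pairing d) {b c h : HalfEdge d} (h1 : h ≠ b) (h2 : h ≠ c)
    (h3 : σ.1 h ≠ b) (h4 : σ.1 h ≠ c) : (σ.switch b c).1 h = σ.1 h := by
  rw [Pairing.switch_apply, Equiv.swap_apply_of_ne_of_ne h1 h2, Equiv.swap_apply_of_ne_of_ne h3 h4]

theorem card_halfEdges_mem (S : Finset (Fin n)) :
    (Finset.univ.filter fun h : HalfEdge d => h.1 ∈ S).card = ∑ v ∈ S, d v := by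
  have : (Finset.univ.filter fun h : HalfEdge d => h.1 ∈ S) = S.sigma fun v => Finset.univ := by
    ext ⟨v, j⟩; simp
  rw [this, Finset.card_sigma]
  simp

theorem card_halfEdges_at (v : Fin n) :
    (Finset.univ.filter fun h : HalfEdge d => h.1 = v).card = d v := by
  simpa using card_halfEdges_mem (d := d) {v}

theorem card_halfEdge : Fintype.card (HalfEdge d) = ∑ v, d v := by simp

open scoped Classical in
noncomputable instance : Fintype (Pairing d) := inferInstance

/-- The vertices selected before `v`. -/
noncomputable def chosenBefore (σ : Pairing d) (π : Equiv.Perm (Fin n)) (v : Fin n) :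
    Finset (Fin n) :=
  (chosen σ π).filter fun w => π.symm w < π.symm v

theorem mem_chosenBefore {σ : Pairing d} {π : Equiv.Perm (Fin n)} {v w : Fin n} :
    w ∈ chosenBefore σ π v ↔ w ∈ chosen σ π ∧ π.symm w < π.symm v := by
  simp [chosenBefore]

open scoped Classical in
/-- For a fixed order, `v` is rarely selected after vertices that carry many half-edges:
exchanging the partners of a half-edge `b` of `v` and of the partner of a half-edge `a` of a vertex
selected before `v` turns an outcome with `v` selected into one in which `v` is first blocked by
the vertex of `a`. The first blocker of `v` is unique, so the image determines `a` up to two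
choices; the only other datum is the former partner of `a`. -/
theorem sum_chosenBefore_le (π : Equiv.Perm (Fin n)) (v : Fin n) :
    ∑ σ : Pairing d, (if v ∈ chosen σ π then d v * ∑ w ∈ chosenBefore σ π v, d w else 0) ≤
      2 * (∑ w, d w) * Fintype.card (Pairing d) := by
  -- `a` is a half-edge of the first selected neighbour of `v`, joined to `v` by at most two edges;
  -- there are two if the old partner of `a` lies at the same vertex and that of `b` lies at `v`
  let P : Pairing d → HalfEdge d → Prop := fun σ a =>
    (σ.1 a).1 = v ∧ a.1 ∈ chosen σ π ∧
      (∀ k : HalfEdge d, k.1 ∈ chosen σ π → π.symm k.1 < π.symm a.1 → (σ.1 k).1 ≠ v) ∧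
      (Finset.univ.filter fun x : HalfEdge d => x.1 = a.1 ∧ (σ.1 x).1 = v).card ≤ 2
  let src : Finset (Σ _ : Pairing d, HalfEdge d × HalfEdge d) := Finset.univ.sigma fun σ =>
    if v ∈ chosen σ π then (Finset.univ.filter fun a : HalfEdge d => a.1 = v) ×ˢ
      (Finset.univ.filter fun a : HalfEdge d => a.1 ∈ chosenBefore σ π v) else ∅
  let tgt : Finset (Σ _ : Pairing d, HalfEdge d × HalfEdge d) := Finset.univ.sigma fun σ =>
    (Finset.univ.filter fun a : HalfEdge d => P σ a) ×ˢ (Finset.univ : Finset (HalfEdge d))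
  have hsrc : src.card =
      ∑ σ : Pairing d, (if v ∈ chosen σ π then d v * ∑ w ∈ chosenBefore σ π v, d w else 0) := by
    rw [Finset.card_sigma]
    refine Finset.sum_congr rfl fun σ _ => ?_
    split_ifs
    · rw [Finset.card_product, card_halfEdges_at, card_halfEdges_mem]
    · rfl
  have htgt : tgt.card ≤ 2 * (∑ w, d w) * Fintype.card (Pairing d) := by
    rw [Finset.card_sigma, mul_comm, ← smul_eq_mul, ← Finset.card_univ]
    refine Finset.sum_le_card_nsmul _ _ _ fun σ _ => ?_
    rw [Finset.card_product, Finset.card_univ, card_halfEdge]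
    refine Nat.mul_le_mul_right _ ?_
    by_cases hne : ∃ a, P σ a
    · obtain ⟨a, ha⟩ := hne
      refine le_trans (Finset.card_le_card fun x hx => ?_) ha.2.2.2
      have hx : P σ x := by simpa using hx
      simp only [Finset.mem_filter, Finset.mem_univ, true_and]
      refine ⟨?_, hx.1⟩
      by_contra hxa
      rcases lt_or_gt_of_ne fun h => hxa (π.symm.injective h) with hlt | hlt
      · exact ha.2.2.1 x hx.2.1 hlt hx.1
      · exact hx.2.2.1 a ha.2.1 hlt ha.1
    · push Not at hne
      simp [hne]
  rw [← hsrc]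
  refine le_trans ?_ htgt
  let f : (Σ _ : Pairing d, HalfEdge d × HalfEdge d) → (Σ _ : Pairing d, HalfEdge d × HalfEdge d) :=
    fun p => ⟨p.1.switch p.2.1 (p.1.1 p.2.2), (p.2.2, p.1.1 p.2.2)⟩
  let g : (Σ _ : Pairing d, HalfEdge d × HalfEdge d) → (Σ _ : Pairing d, HalfEdge d × HalfEdge d) :=
    fun p => ⟨p.1.switch (p.1.1 p.2.1) p.2.2, (p.1.1 p.2.1, p.2.1)⟩
  have key : ∀ p ∈ src, v ∈ chosen p.1 π ∧ p.2.1.1 = v ∧ p.2.2.1 ∈ chosen p.1 π ∧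
      π.symm p.2.2.1 < π.symm v ∧ (p.1.switch p.2.1 (p.1.1 p.2.2)).1 p.2.2 = p.2.1 := by
    rintro ⟨σ, b, a⟩ hp
    simp only [src, Finset.mem_sigma, Finset.mem_univ, true_and] at hp
    split_ifs at hp with hv
    · simp only [Finset.mem_product, Finset.mem_filter, Finset.mem_univ, true_and,
        mem_chosenBefore] at hp
      obtain ⟨hb, ha, hlt⟩ := hp
      refine ⟨hv, hb, ha, hlt, ?_⟩
      have hab : a ≠ b := by
        rintro rfl
        rw [hb] at hlt
        exact lt_irrefl _ hlt
      change (σ.switch b (σ.1 a)).1 a = b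
      rw [Pairing.switch_apply, Equiv.swap_apply_of_ne_of_ne hab (σ.2.2 a).symm,
        Equiv.swap_apply_right]
    · simp at hp
  refine Finset.card_le_card_of_injOn f ?_ ?_
  · intro p hp
    obtain ⟨hv, hb, ha, hlt, hab⟩ := key p hp
    obtain ⟨σ, b, a⟩ := p
    dsimp only at hv hb ha hlt hab
    simp only [f, tgt, Finset.coe_sigma, Finset.coe_univ, Finset.coe_product, Set.mem_sigma_iff,
      Set.mem_univ, Set.mem_prod, Finset.mem_coe, Finset.mem_filter, Finset.mem_univ, true_and,
      and_true]
    have hv' := (mem_chosen_iff σ π v).1 hv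
    have ha' := (mem_chosen_iff σ π a.1).1 ha
    have hne : ∀ k : HalfEdge d, k.1 ∈ chosen σ π → π.symm k.1 < π.symm a.1 →
        (σ.switch b (σ.1 a)).1 k = σ.1 k := by
      intro k hk hka
      refine σ.switch_apply_of_ne ?_ ?_ ?_ ?_
      · rintro rfl
        exact lt_asymm hka (hb ▸ hlt)
      · rintro rfl
        exact ha' _ hk hka (by rw [σ.2.1 a])
      · intro h
        exact hv' k hk (hka.trans hlt) (by rw [h, hb])
      · intro h
        rw [σ.1.injective h] at hka
        exact lt_irrefl _ hka
    have hcongr := mem_chosen_congr hne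
    refine ⟨by rw [hab, hb], (hcongr _ le_rfl).2 ha, ?_, ?_⟩
    · intro k hk hka
      have hk' := (hcongr _ hka.le).1 hk
      rw [hne k hk' hka]
      exact hv' k hk' (hka.trans hlt)
    · refine le_trans (Finset.card_le_card (t := {a, σ.1 a}) fun x hx => ?_) Finset.card_le_two
      simp only [Finset.mem_filter, Finset.mem_univ, true_and] at hx
      obtain ⟨hx1, hx2⟩ := hx
      by_contra hxn
      simp only [Finset.mem_insert, Finset.mem_singleton, not_or] at hxn
      have hxb : x ≠ b := by
        rintro rfl
        rw [← hx1, hb] at hlt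
        exact lt_irrefl _ hlt
      have hσx : (σ.1 x).1 ≠ v := hv' x (hx1 ▸ ha) (hx1 ▸ hlt)
      rw [σ.switch_apply_of_ne hxb hxn.2 (fun h => hσx (by rw [h, hb]))
        (fun h => hxn.1 (σ.1.injective h))] at hx2
      exact hσx hx2
  · refine Set.LeftInvOn.injOn (f₁' := g) fun p hp => ?_
    obtain ⟨-, -, -, -, hab⟩ := key p hp
    obtain ⟨σ, b, a⟩ := p
    dsimp only at hab
    simp only [f, g, hab, Pairing.switch_switch]

open scoped Classical in
/-- The reverse switching: the partner `g` of a half-edge `h` of `i` lies at a selected vertex;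
exchange the partners of `g` and of a half-edge `b` away from the selected vertices. The vertex of
`g` remains selected, so the image records a half-edge of `i` and a half-edge of a selected vertex,
whereas at least half of all half-edges are available as `b`. -/
theorem card_not_mem_chosen_mul_le (π : Equiv.Perm (Fin n)) (i : Fin n) :
    (Finset.univ.filter fun σ : Pairing d =>
        i ∉ chosen σ π ∧ 4 * ∑ w ∈ chosen σ π, d w ≤ ∑ w, d w).card * ∑ w, d w ≤
      2 * d i * ∑ σ : Pairing d, ∑ w ∈ chosen σ π, d w := by
  let B : Pairing d → Finset (HalfEdge d) := fun σ =>
    Finset.univ.filter fun b : HalfEdge d => b.1 ∉ chosen σ π ∧ (σ.1 b).1 ∉ chosen σ π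
  let bad : Finset (Pairing d) := Finset.univ.filter fun σ : Pairing d =>
        i ∉ chosen σ π ∧ 4 * ∑ w ∈ chosen σ π, d w ≤ ∑ w, d w
  let src : Finset (Σ _ : Pairing d, HalfEdge d × HalfEdge d) := bad.sigma fun σ =>
    (Finset.univ.filter fun h : HalfEdge d => h.1 = i ∧ (σ.1 h).1 ∈ chosen σ π) ×ˢ B σ
  let tgt : Finset (Σ _ : Pairing d, HalfEdge d × HalfEdge d) := Finset.univ.sigma fun σ =>
    (Finset.univ.filter fun h : HalfEdge d => h.1 = i) ×ˢ
      (Finset.univ.filter fun g : HalfEdge d => g.1 ∈ chosen σ π)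
  have htgt : tgt.card = d i * ∑ σ : Pairing d, ∑ w ∈ chosen σ π, d w := by
    rw [Finset.card_sigma, Finset.mul_sum]
    refine Finset.sum_congr rfl fun σ _ => ?_
    rw [Finset.card_product, card_halfEdges_at, card_halfEdges_mem]
  have hsrc : bad.card * ∑ w, d w ≤ 2 * src.card := by
    rw [Finset.card_sigma, Finset.mul_sum bad, ← smul_eq_mul bad.card]
    refine Finset.card_nsmul_le_sum bad _ (∑ w, d w) fun σ hσ => ?_
    obtain ⟨hi, hY⟩ : i ∉ chosen σ π ∧ 4 * ∑ w ∈ chosen σ π, d w ≤ ∑ w, d w := by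
      simpa [bad] using hσ
    rw [Finset.card_product]
    have h1 : 1 ≤ (Finset.univ.filter
        fun h : HalfEdge d => h.1 = i ∧ (σ.1 h).1 ∈ chosen σ π).card := by
      rw [mem_chosen_iff] at hi
      push Not at hi
      obtain ⟨h, hh, -, heq⟩ := hi
      rw [Nat.one_le_iff_ne_zero, Finset.card_ne_zero]
      exact ⟨σ.1 h, by simp [heq, σ.2.1 h, hh]⟩
    have h2 : ∑ w, d w ≤ 2 * (B σ).card := by
      have hc : (Finset.univ : Finset (HalfEdge d)) ⊆ B σ ∪
          ((Finset.univ.filter fun h : HalfEdge d => h.1 ∈ chosen σ π) ∪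
          (Finset.univ.filter fun h : HalfEdge d => h.1 ∈ chosen σ π).image σ.1) := by
        intro h _
        by_cases hh : h.1 ∈ chosen σ π
        · simp [hh]
        · by_cases hh' : (σ.1 h).1 ∈ chosen σ π
          · rw [Finset.mem_union, Finset.mem_union]
            refine Or.inr (Or.inr (Finset.mem_image.2 ⟨σ.1 h, by simpa using hh', σ.2.1 h⟩))
          · simp [B, hh, hh']
      have hc := (Finset.card_le_card hc).trans ((Finset.card_union_le _ _).trans
        (Nat.add_le_add_left (Finset.card_union_le _ _) _))
      have hi := Finset.card_image_le (f := σ.1)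
        (s := Finset.univ.filter fun h : HalfEdge d => h.1 ∈ chosen σ π)
      rw [card_halfEdges_mem] at hc hi
      rw [Finset.card_univ, card_halfEdge] at hc
      omega
    have h3 := Nat.mul_le_mul_right (B σ).card h1
    omega
  have hle : src.card ≤ tgt.card := by
    let f : (Σ _ : Pairing d, HalfEdge d × HalfEdge d) →
        (Σ _ : Pairing d, HalfEdge d × HalfEdge d) :=
      fun p => ⟨p.1.switch (p.1.1 p.2.1) p.2.2, (p.2.1, p.1.1 p.2.1)⟩
    let g : (Σ _ : Pairing d, HalfEdge d × HalfEdge d) →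
        (Σ _ : Pairing d, HalfEdge d × HalfEdge d) :=
      fun p => ⟨p.1.switch p.2.2 (p.1.1 p.2.1), (p.2.1, p.1.1 p.2.1)⟩
    have key : ∀ p ∈ src, i ∉ chosen p.1 π ∧ p.2.1.1 = i ∧ (p.1.1 p.2.1).1 ∈ chosen p.1 π ∧
        p.2.2.1 ∉ chosen p.1 π ∧ (p.1.1 p.2.2).1 ∉ chosen p.1 π ∧
        (p.1.switch (p.1.1 p.2.1) p.2.2).1 p.2.1 = p.2.2 := by
      rintro ⟨σ, h, b⟩ hp
      simp only [src, bad, B, Finset.mem_sigma, Finset.mem_product, Finset.mem_filter,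
        Finset.mem_univ, true_and] at hp
      obtain ⟨⟨hi, -⟩, ⟨hh, hg⟩, hb, hb'⟩ := hp
      refine ⟨hi, hh, hg, hb, hb', ?_⟩
      have hhb : h ≠ b := by
        rintro rfl
        exact hb' hg
      change (σ.switch (σ.1 h) b).1 h = b
      rw [Pairing.switch_apply, Equiv.swap_apply_of_ne_of_ne (σ.2.2 h).symm hhb,
        Equiv.swap_apply_left]
    refine Finset.card_le_card_of_injOn f ?_ ?_
    · intro p hp
      obtain ⟨hi, hh, hg, hb, hb', -⟩ := key p hp
      obtain ⟨σ, h, b⟩ := p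
      dsimp only at hi hh hg hb hb'
      simp only [f, tgt, Finset.coe_sigma, Finset.coe_univ, Finset.coe_product, Set.mem_sigma_iff,
        Set.mem_univ, Set.mem_prod, Finset.mem_coe, Finset.mem_filter, Finset.mem_univ, true_and]
      refine ⟨hh, (mem_chosen_congr (fun k hk hlt => ?_) _ le_rfl).2 hg⟩
      refine σ.switch_apply_of_ne ?_ ?_ ?_ ?_
      · rintro rfl
        exact lt_irrefl _ hlt
      · rintro rfl
        exact hb hk
      · intro hk'
        rw [σ.1.injective hk', hh] at hk
        exact hi hk
      · rintro rfl
        rw [σ.2.1 k] at hb'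
        exact hb' hk
    · refine Set.LeftInvOn.injOn (f₁' := g) fun p hp => ?_
      obtain ⟨-, -, -, -, -, hab⟩ := key p hp
      obtain ⟨σ, h, b⟩ := p
      dsimp only at hab
      simp only [f, g, hab, Pairing.switch_switch]
  calc bad.card * ∑ w, d w ≤ 2 * src.card := hsrc
    _ ≤ 2 * tgt.card := by gcongr
    _ = _ := by rw [htgt, mul_assoc]

/-! ### The second moment of the degree sum of the selected set -/

theorem sq_sum_chosen_le (σ : Pairing d) (π : Equiv.Perm (Fin n)) :
    (∑ v ∈ chosen σ π, d v) ^ 2 ≤ ∑ v ∈ chosen σ π, d v ^ 2 +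
      2 * ∑ v ∈ chosen σ π, d v * ∑ w ∈ chosenBefore σ π v, d w := by
  set S := chosen σ π
  have hlow : ∑ v ∈ S, d v * ∑ w ∈ chosenBefore σ π v, d w =
      ∑ v ∈ S, ∑ w ∈ S, if π.symm w < π.symm v then d v * d w else 0 := by
    refine Finset.sum_congr rfl fun v _ => ?_
    rw [chosenBefore, Finset.mul_sum, Finset.sum_filter]
  have hdiag : ∑ v ∈ S, d v ^ 2 = ∑ v ∈ S, ∑ w ∈ S, if v = w then d v * d w else 0 := by
    refine Finset.sum_congr rfl fun v hv => ?_
    rw [Finset.sum_ite_eq, if_pos hv, sq]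
  have hup : ∑ v ∈ S, ∑ w ∈ S, (if π.symm w < π.symm v then d v * d w else 0) =
      ∑ v ∈ S, ∑ w ∈ S, if π.symm v < π.symm w then d v * d w else 0 := by
    rw [Finset.sum_comm]
    simp only [mul_comm]
  rw [two_mul, hlow, hdiag, sq, Finset.sum_mul_sum]
  conv_rhs => enter [2, 2]; rw [hup]
  simp only [← Finset.sum_add_distrib]
  refine Finset.sum_le_sum fun v _ => Finset.sum_le_sum fun w _ => ?_
  rcases lt_trichotomy (π.symm v) (π.symm w) with h | h | h
  · rw [if_pos h]
    omega
  · simp [π.symm.injective h]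
  · rw [if_pos h]
    omega

/-- The number of vertices of positive degree that precede `v` in the order `π`. -/
def rankPos (d : Fin n → ℕ) (π : Equiv.Perm (Fin n)) (v : Fin n) : ℕ :=
  (Finset.univ.filter fun w => d w ≠ 0 ∧ π.symm w < π.symm v).card

/-- Each vertex of positive degree considered before `v` is selected or adjacent to a vertex
selected before `v`, so it is one of the two ends of an edge at such a vertex. -/
theorem rankPos_le (σ : Pairing d) (π : Equiv.Perm (Fin n)) (v : Fin n) :
    rankPos d π v ≤ 2 * ∑ w ∈ chosenBefore σ π v, d w := by
  classical
  set B := chosenBefore σ π v with hB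
  let A := Finset.univ.filter fun h : HalfEdge d => h.1 ∈ B
  have hsub : (Finset.univ.filter fun w => d w ≠ 0 ∧ π.symm w < π.symm v) ⊆
      A.image Sigma.fst ∪ A.image fun h => (σ.1 h).1 := by
    intro w hw
    obtain ⟨hw0, hwv⟩ : d w ≠ 0 ∧ π.symm w < π.symm v := by simpa using hw
    rw [Finset.mem_union, Finset.mem_image, Finset.mem_image]
    by_cases hc : w ∈ chosen σ π
    · refine Or.inl ⟨⟨w, ⟨0, Nat.pos_of_ne_zero hw0⟩⟩, ?_, rfl⟩
      simp [A, hB, mem_chosenBefore, hc, hwv]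
    · rw [mem_chosen_iff] at hc
      push Not at hc
      obtain ⟨h, hh, hlt, heq⟩ := hc
      refine Or.inr ⟨h, ?_, heq⟩
      simp [A, hB, mem_chosenBefore, hh, hlt.trans hwv]
  have hA : A.card = ∑ w ∈ B, d w := card_halfEdges_mem B
  have h1 := Finset.card_image_le (s := A) (f := Sigma.fst)
  have h2 := Finset.card_image_le (s := A) (f := fun h => (σ.1 h).1)
  have h3 := (Finset.card_le_card hsub).trans (Finset.card_union_le _ _)
  rw [rankPos]
  omega

theorem rankPos_swap_mul (π : Equiv.Perm (Fin n)) {u v : Fin n} (hu : d u ≠ 0) (hv : d v ≠ 0) :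
    rankPos d (Equiv.swap u v * π) v = rankPos d π u := by
  have hd : ∀ w, d (Equiv.swap u v w) ≠ 0 ↔ d w ≠ 0 := by
    intro w
    rw [Equiv.swap_apply_def]
    split_ifs with h1 h2 <;> simp_all
  have hs : ∀ w, (Equiv.swap u v * π).symm w = π.symm (Equiv.swap u v w) := by
    intro w
    rw [Equiv.symm_apply_eq]
    simp
  refine Finset.card_bij (fun w _ => Equiv.swap u v w) ?_ ?_ ?_
  · intro w hw
    simpa [hs, hd] using hw
  · intro a _ b _ h
    exact (Equiv.swap u v).injective h
  · intro w hw
    exact ⟨Equiv.swap u v w, by simpa [hs, hd] using hw, by simp⟩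

theorem card_rankPos_lt_le (π : Equiv.Perm (Fin n)) (T : ℕ) :
    (Finset.univ.filter fun v => d v ≠ 0 ∧ rankPos d π v < T).card ≤ T := by
  conv_rhs => rw [← Finset.card_range T]
  have hmono : ∀ u v, d u ≠ 0 → π.symm u < π.symm v → rankPos d π u < rankPos d π v := by
    intro u v hu huv
    refine Finset.card_lt_card (Finset.ssubset_iff_of_subset ?_ |>.2 ⟨u, ?_, ?_⟩)
    · intro w hw
      simp only [Finset.mem_filter, Finset.mem_univ, true_and] at hw ⊢
      exact ⟨hw.1, hw.2.trans huv⟩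
    · simp [hu, huv]
    · simp
  refine Finset.card_le_card_of_injOn (rankPos d π) (fun v hv => ?_) fun u hu v hv huv => ?_
  · simpa using (Finset.mem_filter.1 hv).2.2
  · simp only [Finset.coe_filter, Finset.mem_univ, true_and, Set.mem_ofPred_eq] at hu hv
    by_contra hne
    rcases lt_or_gt_of_ne fun h => hne (π.symm.injective h) with hlt | hlt
    · exact (hmono u v hu.1 hlt).ne huv
    · exact (hmono v u hv.1 hlt).ne huv.symm

/-- In a uniform order, the rank of `v` among the vertices of positive degree is uniform. -/
theorem card_perm_rankPos_lt_mul_le {v : Fin n} (hv : d v ≠ 0) (T : ℕ) :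
    (Finset.univ.filter fun π : Equiv.Perm (Fin n) => rankPos d π v < T).card *
      (Finset.univ.filter fun w => d w ≠ 0).card ≤ T * Fintype.card (Equiv.Perm (Fin n)) := by
  have h1 : ∀ u, d u ≠ 0 →
      (Finset.univ.filter fun π : Equiv.Perm (Fin n) => rankPos d π u < T).card =
      (Finset.univ.filter fun π : Equiv.Perm (Fin n) => rankPos d π v < T).card := by
    intro u hu
    refine Finset.card_bij (fun π _ => Equiv.swap u v * π) ?_ ?_ ?_
    · intro π hπ
      simpa [rankPos_swap_mul π hu hv] using hπ
    · intro a _ b _ h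
      exact mul_left_cancel h
    · intro π hπ
      refine ⟨Equiv.swap u v * π, ?_, by simp [← mul_assoc]⟩
      rw [Finset.mem_filter] at hπ ⊢
      rw [Equiv.swap_comm, rankPos_swap_mul π hv hu]
      exact ⟨Finset.mem_univ _, hπ.2⟩
  calc _ = ∑ u ∈ Finset.univ.filter fun w => d w ≠ 0,
        (Finset.univ.filter fun π : Equiv.Perm (Fin n) => rankPos d π u < T).card := by
        rw [Finset.sum_congr rfl fun u hu => h1 u (Finset.mem_filter.1 hu).2, Finset.sum_const,
          smul_eq_mul, mul_comm]
    _ = ∑ u ∈ Finset.univ.filter fun w => d w ≠ 0,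
        ∑ π : Equiv.Perm (Fin n), if rankPos d π u < T then 1 else 0 := by
        simp only [Finset.card_filter]
    _ = ∑ π : Equiv.Perm (Fin n),
        (Finset.univ.filter fun v => d v ≠ 0 ∧ rankPos d π v < T).card := by
        rw [Finset.sum_comm]
        simp only [← Finset.filter_filter, Finset.card_filter]
    _ ≤ ∑ π : Equiv.Perm (Fin n), T := Finset.sum_le_sum fun π _ => card_rankPos_lt_le π T
    _ = _ := by rw [Finset.sum_const, Finset.card_univ, smul_eq_mul, mul_comm]

/-- The degree sum of the selected set, as a random variable. -/
noncomputable def chosenDegree (p : Pairing d × Equiv.Perm (Fin n)) : ℕ :=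
  ∑ v ∈ chosen p.1 p.2, d v

/-- A vertex of positive degree that is selected either has small rank, or is selected although
many half-edges have already been used. -/
theorem sum_sq_mem_chosen_le (v : Fin n) {T : ℕ} (hT : 0 < T)
    (hpos : 0 < (Finset.univ.filter fun w => d w ≠ 0).card) :
    (∑ p : Pairing d × Equiv.Perm (Fin n), if v ∈ chosen p.1 p.2 then (d v : ℝ) ^ 2 else 0) ≤
      Fintype.card (Pairing d × Equiv.Perm (Fin n)) *
        ((d v : ℝ) ^ 2 * (T / (Finset.univ.filter fun w => d w ≠ 0).card) +
          d v * (4 * (∑ w, d w : ℕ) / T)) := by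
  classical
  set k := (Finset.univ.filter fun w => d w ≠ 0).card
  set M := ∑ w, d w
  have hT' : (0 : ℝ) < T := by exact_mod_cast hT
  have hk' : (0 : ℝ) < k := by exact_mod_cast hpos
  rcases eq_or_ne (d v) 0 with hv | hv
  · simp [hv]
  have hpt : ∀ p : Pairing d × Equiv.Perm (Fin n),
      (if v ∈ chosen p.1 p.2 then (d v : ℝ) ^ 2 else 0) ≤
      (d v : ℝ) ^ 2 * (if rankPos d p.2 v < T then 1 else 0) + (d v * (2 / T)) *
        ((if v ∈ chosen p.1 p.2 then d v * ∑ w ∈ chosenBefore p.1 p.2 v, d w else 0 : ℕ) : ℝ) := by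
    intro p
    split_ifs with h1 h2
    · have : (0 : ℝ) ≤ (d v * (2 / T)) *
        ((d v * ∑ w ∈ chosenBefore p.1 p.2 v, d w : ℕ) : ℝ) := by positivity
      linarith
    · have h3 : T ≤ 2 * ∑ w ∈ chosenBefore p.1 p.2 v, d w :=
        (not_lt.1 h2).trans (rankPos_le p.1 p.2 v)
      have h3' : (T : ℝ) ≤ 2 * (∑ w ∈ chosenBefore p.1 p.2 v, d w : ℕ) := by exact_mod_cast h3
      rw [mul_zero, zero_add, Nat.cast_mul]
      calc (d v : ℝ) ^ 2 = (d v : ℝ) ^ 2 / T * T := by field_simp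
        _ ≤ (d v : ℝ) ^ 2 / T * (2 * (∑ w ∈ chosenBefore p.1 p.2 v, d w : ℕ)) := by gcongr
        _ = _ := by ring
    · simp
    · simp
  refine (Finset.sum_le_sum fun p _ => hpt p).trans ?_
  rw [Finset.sum_add_distrib, ← Finset.mul_sum, ← Finset.mul_sum, ← Nat.cast_sum,
    Fintype.sum_prod_type, Fintype.sum_prod_type_right]
  have hA : (∑ _σ : Pairing d, ∑ π : Equiv.Perm (Fin n),
      if rankPos d π v < T then (1 : ℝ) else 0) ≤
      Fintype.card (Pairing d × Equiv.Perm (Fin n)) * (T / k) := by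
    have := card_perm_rankPos_lt_mul_le hv T
    have : ((Finset.univ.filter fun π : Equiv.Perm (Fin n) => rankPos d π v < T).card : ℝ) * k ≤
      T * Fintype.card (Equiv.Perm (Fin n)) := by exact_mod_cast this
    rw [Finset.sum_const, nsmul_eq_mul, Finset.card_univ, Fintype.card_prod, Nat.cast_mul,
      mul_assoc, Finset.sum_boole]
    refine mul_le_mul_of_nonneg_left ?_ (Nat.cast_nonneg _)
    rw [← mul_div_assoc, le_div_iff₀ hk', mul_comm _ (T : ℝ)]
    exact this
  have hB : (∑ π : Equiv.Perm (Fin n), ∑ σ : Pairing d,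
      (if v ∈ chosen σ π then d v * ∑ w ∈ chosenBefore σ π v, d w else 0)) ≤
      2 * M * Fintype.card (Pairing d × Equiv.Perm (Fin n)) := by
    refine (Finset.sum_le_sum fun π _ => sum_chosenBefore_le π v).trans (le_of_eq ?_)
    rw [Finset.sum_const, Finset.card_univ, Fintype.card_prod, smul_eq_mul]
    ring
  have hB' : ((∑ π : Equiv.Perm (Fin n), ∑ σ : Pairing d,
      (if v ∈ chosen σ π then d v * ∑ w ∈ chosenBefore σ π v, d w else 0) : ℕ) : ℝ) ≤
      2 * M * Fintype.card (Pairing d × Equiv.Perm (Fin n)) := by exact_mod_cast hB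
  calc _ ≤ (d v : ℝ) ^ 2 * (Fintype.card (Pairing d × Equiv.Perm (Fin n)) * (T / k)) +
        (d v * (2 / T)) * (2 * M * Fintype.card (Pairing d × Equiv.Perm (Fin n))) := by gcongr
    _ = _ := by ring

theorem sum_sq_chosenDegree_le {T : ℕ} (hT : 0 < T)
    (hpos : 0 < (Finset.univ.filter fun w => d w ≠ 0).card) :
    (∑ p : Pairing d × Equiv.Perm (Fin n), (chosenDegree p : ℝ) ^ 2) ≤
      Fintype.card (Pairing d × Equiv.Perm (Fin n)) *
        (4 * n * (∑ w, d w : ℕ) + ((∑ w, d w : ℕ) : ℝ) ^ 2 *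
          (T / (Finset.univ.filter fun w => d w ≠ 0).card + 4 / T)) := by
  classical
  have hD := Finset.sum_le_sum fun v (_ : v ∈ Finset.univ) =>
    sum_sq_mem_chosen_le (d := d) v hT hpos
  set k := (Finset.univ.filter fun w => d w ≠ 0).card
  set M := ∑ w, d w with hM
  set N := Fintype.card (Pairing d × Equiv.Perm (Fin n)) with hN
  have hpt : ∀ p : Pairing d × Equiv.Perm (Fin n), (chosenDegree p : ℝ) ^ 2 ≤
      (∑ v, if v ∈ chosen p.1 p.2 then (d v : ℝ) ^ 2 else 0) + 2 * ((∑ v,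
        if v ∈ chosen p.1 p.2 then d v * ∑ w ∈ chosenBefore p.1 p.2 v, d w else 0 : ℕ) : ℝ) := by
    intro p
    have h := sq_sum_chosen_le p.1 p.2
    simp only [← Finset.sum_filter, Finset.filter_mem_eq_inter, Finset.univ_inter]
    rw [chosenDegree]
    exact_mod_cast h
  have hX : (∑ p : Pairing d × Equiv.Perm (Fin n), ∑ v,
      if v ∈ chosen p.1 p.2 then d v * ∑ w ∈ chosenBefore p.1 p.2 v, d w else 0) ≤
      n * (2 * M * N) := by
    rw [Finset.sum_comm]
    refine (Finset.sum_le_card_nsmul _ _ (2 * M * N) fun v _ => ?_).trans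
      (le_of_eq (by simp))
    rw [Fintype.sum_prod_type_right]
    refine (Finset.sum_le_sum fun π _ => sum_chosenBefore_le π v).trans (le_of_eq ?_)
    rw [Finset.sum_const, Finset.card_univ, hN, Fintype.card_prod, smul_eq_mul]
    ring
  have hX' : ((∑ p : Pairing d × Equiv.Perm (Fin n), ∑ v,
      if v ∈ chosen p.1 p.2 then d v * ∑ w ∈ chosenBefore p.1 p.2 v, d w else 0 : ℕ) : ℝ) ≤
      n * (2 * M * N) := by exact_mod_cast hX
  refine (Finset.sum_le_sum fun p _ => hpt p).trans ?_
  rw [Finset.sum_add_distrib, ← Finset.mul_sum, Finset.sum_comm, ← Nat.cast_sum]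
  refine (add_le_add hD (mul_le_mul_of_nonneg_left hX' zero_le_two)).trans ?_
  have hsq : ∑ v, (d v : ℝ) ^ 2 ≤ (M : ℝ) ^ 2 := by
    rw [hM]
    push_cast
    exact Finset.sum_sq_le_sq_sum_of_nonneg fun i _ => Nat.cast_nonneg _
  have hMs : ∑ v, (d v : ℝ) = M := by rw [hM]; push_cast; rfl
  rw [← Finset.mul_sum, Finset.sum_add_distrib, ← Finset.sum_mul, ← Finset.sum_mul, hMs]
  have : (∑ v, (d v : ℝ) ^ 2) * ((T : ℝ) / k) ≤ (M : ℝ) ^ 2 * (T / k) := by gcongr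
  calc _ ≤ (N : ℝ) * ((M : ℝ) ^ 2 * (T / k) + M * (4 * M / T)) + 2 * (n * (2 * M * N)) := by
        gcongr
    _ = _ := by ring

/-! ### Few vertices of low degree are blocked -/

theorem sum_chosenDegree_le {M q : ℝ} (hM : 0 ≤ M)
    (hq : (∑ p : Pairing d × Equiv.Perm (Fin n), (chosenDegree p : ℝ) ^ 2) ≤
      Fintype.card (Pairing d × Equiv.Perm (Fin n)) * (M ^ 2 * q)) :
    (∑ p : Pairing d × Equiv.Perm (Fin n), (chosenDegree p : ℝ)) ≤
      Fintype.card (Pairing d × Equiv.Perm (Fin n)) * (M * √q) := by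
  set N := Fintype.card (Pairing d × Equiv.Perm (Fin n)) with hN
  have h := sq_sum_le_card_mul_sum_sq (s := (Finset.univ : Finset (Pairing d × Equiv.Perm (Fin n))))
    (f := fun p => (chosenDegree p : ℝ))
  rw [Finset.card_univ, ← hN] at h
  have h2 : (∑ p : Pairing d × Equiv.Perm (Fin n), (chosenDegree p : ℝ)) ^ 2 ≤ (N * M) ^ 2 * q := by
    refine h.trans ((mul_le_mul_of_nonneg_left hq (Nat.cast_nonneg _)).trans (le_of_eq ?_))
    ring
  calc _ ≤ √((N * M) ^ 2 * q) := Real.le_sqrt_of_sq_le h2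
    _ = _ := by
      rw [Real.sqrt_mul (sq_nonneg _), Real.sqrt_sq (by positivity), mul_assoc]

open scoped Classical in
/-- Markov's inequality, applied to the number of vertices of `L` that are blocked while the
selected vertices carry at most a quarter of the half-edges, and to the squared degree sum of the
selected set otherwise. -/
theorem card_chosen_lt_le {D δ q : ℝ} (hD : 0 ≤ D) (hδ : 0 < δ) (hM : 0 < ∑ w, d w)
    (hq : (∑ p : Pairing d × Equiv.Perm (Fin n), (chosenDegree p : ℝ) ^ 2) ≤
      Fintype.card (Pairing d × Equiv.Perm (Fin n)) * (((∑ w, d w : ℕ) : ℝ) ^ 2 * q))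
    (L : Finset (Fin n)) (hL : ∀ i ∈ L, (d i : ℝ) ≤ D) :
    ((Finset.univ.filter fun p : Pairing d × Equiv.Perm (Fin n) =>
        ((chosen p.1 p.2).card : ℝ) < (1 - δ) * L.card).card : ℝ) ≤
      Fintype.card (Pairing d × Equiv.Perm (Fin n)) * (2 * (D * √q) / δ + 16 * q) := by
  set M := ∑ w, d w with hMdef
  have hM' : (0 : ℝ) < M := by exact_mod_cast hM
  set N := Fintype.card (Pairing d × Equiv.Perm (Fin n)) with hN
  have hsum := sum_chosenDegree_le hM'.le hq
  let bad : Pairing d × Equiv.Perm (Fin n) → Fin n → Prop := fun p i =>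
    i ∉ chosen p.1 p.2 ∧ 4 * ∑ w ∈ chosen p.1 p.2, d w ≤ M
  have hbad : ∀ i ∈ L, (∑ p : Pairing d × Equiv.Perm (Fin n), if bad p i then (1 : ℝ) else 0) ≤
      2 * D * (N * √q) := by
    intro i hi
    have h1 : (∑ p : Pairing d × Equiv.Perm (Fin n), if bad p i then 1 else 0) * M ≤
        2 * d i * ∑ p : Pairing d × Equiv.Perm (Fin n), chosenDegree p := by
      rw [Fintype.sum_prod_type_right, Fintype.sum_prod_type_right, Finset.sum_mul, Finset.mul_sum]
      refine Finset.sum_le_sum fun π _ => ?_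
      rw [← Finset.card_filter]
      exact card_not_mem_chosen_mul_le π i
    have h2 : (∑ p : Pairing d × Equiv.Perm (Fin n), if bad p i then (1 : ℝ) else 0) * M ≤
        2 * d i * ∑ p : Pairing d × Equiv.Perm (Fin n), (chosenDegree p : ℝ) := by
      exact_mod_cast h1
    refine le_of_mul_le_mul_right ?_ hM'
    calc _ ≤ 2 * d i * ∑ p : Pairing d × Equiv.Perm (Fin n), (chosenDegree p : ℝ) := h2
      _ ≤ 2 * D * (N * (M * √q)) := by
        have := hL i hi
        gcongr
      _ = _ := by ring
  have hpt : ∀ p : Pairing d × Equiv.Perm (Fin n),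
      (if ((chosen p.1 p.2).card : ℝ) < (1 - δ) * L.card then (1 : ℝ) else 0) ≤
      (δ * L.card)⁻¹ * (∑ i ∈ L, if bad p i then (1 : ℝ) else 0) +
        16 / (M : ℝ) ^ 2 * (chosenDegree p : ℝ) ^ 2 := by
    intro p
    have hA : 0 ≤ (δ * L.card)⁻¹ * (∑ i ∈ L, if bad p i then (1 : ℝ) else 0) :=
      mul_nonneg (by positivity) (Finset.sum_nonneg fun i _ => by split_ifs <;> norm_num)
    have hB : 0 ≤ 16 / (M : ℝ) ^ 2 * (chosenDegree p : ℝ) ^ 2 := by positivity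
    split_ifs with hlt
    swap
    · exact add_nonneg hA hB
    by_cases hY : 4 * chosenDegree p ≤ M
    · refine le_add_of_le_of_nonneg ?_ hB
      have hLpos : (0 : ℝ) < L.card := by
        rcases Nat.eq_zero_or_pos L.card with h0 | h0
        · rw [h0, Nat.cast_zero, mul_zero] at hlt
          exact absurd hlt (not_lt.2 (Nat.cast_nonneg _))
        · exact_mod_cast h0
      rw [inv_mul_eq_div, le_div_iff₀ (by positivity), one_mul]
      have h1 : (∑ i ∈ L, if bad p i then (1 : ℝ) else 0) = (L \ chosen p.1 p.2).card := by
        rw [Finset.sum_boole]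
        congr 2
        ext i
        simp only [Finset.mem_filter, Finset.mem_sdiff, bad]
        exact ⟨fun h => ⟨h.1, h.2.1⟩, fun h => ⟨h.1, h.2, hY⟩⟩
      have h2 : L.card ≤ (L \ chosen p.1 p.2).card + (chosen p.1 p.2).card := by
        have := Finset.le_card_sdiff (chosen p.1 p.2) L
        omega
      have h2' : (L.card : ℝ) ≤ (L \ chosen p.1 p.2).card + (chosen p.1 p.2).card := by
        exact_mod_cast h2
      rw [h1]
      linarith
    · refine le_add_of_nonneg_of_le hA ?_
      have hY' : (M : ℝ) ≤ 4 * chosenDegree p := by exact_mod_cast (not_le.1 hY).le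
      rw [div_mul_eq_mul_div, le_div_iff₀ (by positivity), one_mul]
      calc (M : ℝ) ^ 2 ≤ (4 * chosenDegree p) ^ 2 := by gcongr
        _ = _ := by ring
  rw [← Finset.sum_boole]
  refine (Finset.sum_le_sum fun p _ => hpt p).trans ?_
  rw [Finset.sum_add_distrib, ← Finset.mul_sum, ← Finset.mul_sum, Finset.sum_comm, mul_add]
  refine add_le_add ?_ ?_
  · have h1 := Finset.sum_le_card_nsmul L _ _ hbad
    rw [nsmul_eq_mul] at h1
    rcases Nat.eq_zero_or_pos L.card with h0 | h0
    · rw [h0, Nat.cast_zero, mul_zero, inv_zero, zero_mul]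
      positivity
    · have hLpos : (0 : ℝ) < L.card := by exact_mod_cast h0
      refine (mul_le_mul_of_nonneg_left h1 (by positivity)).trans (le_of_eq ?_)
      field_simp
  · refine (mul_le_mul_of_nonneg_left hq (by positivity)).trans (le_of_eq ?_)
    field_simp

/-- Isolated vertices are always selected. -/
theorem card_filter_eq_zero_le_card_chosen (σ : Pairing d) (π : Equiv.Perm (Fin n)) :
    (Finset.univ.filter fun i => d i = 0).card ≤ (chosen σ π).card := by
  refine Finset.card_le_card fun v hv => ?_
  rw [mem_chosen_iff]
  rintro h - - rfl
  exact absurd (Finset.mem_filter.1 hv).2 (σ.1 h).2.pos.ne'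

/-! ### The uniform law -/

/-- An even number of half-edges can be paired: match the two halves of an enumeration. -/
theorem nonempty_pairing (h : Even (∑ i, d i)) : Nonempty (Pairing d) := by
  obtain ⟨m, hm⟩ := h
  have e : Fin m ⊕ Fin m ≃ HalfEdge d := Fintype.equivOfCardEq (by rw [card_halfEdge, hm]; simp)
  refine ⟨⟨(e.symm.trans (Equiv.sumComm _ _)).trans e, fun h => by simp, fun h hh => ?_⟩⟩
  simp only [Equiv.trans_apply] at hh
  rw [← Equiv.eq_symm_apply] at hh
  cases hx : e.symm h <;> simp [hx] at hh

instance : MeasurableSingletonClass (Outcome d) := ⟨fun _ => trivial⟩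

noncomputable instance : Fintype (Outcome d) :=
  inferInstanceAs (Fintype (Pairing d × Equiv.Perm (Fin n)))

theorem isProbabilityMeasure_outcomeLaw (h : Even (∑ i, d i)) :
    MeasureTheory.IsProbabilityMeasure (outcomeLaw d) := by
  have : Nonempty (Pairing d) := nonempty_pairing h
  have : Nonempty (Outcome d) := inferInstanceAs (Nonempty (Pairing d × Equiv.Perm (Fin n)))
  exact isProbabilityMeasure_uniformOn Set.finite_univ Set.univ_nonempty

open scoped Classical in
theorem one_sub_le_outcomeLaw (h : Even (∑ i, d i)) (E : Set (Outcome d)) {ε : ℝ}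
    (hE : ((Finset.univ.filter fun ω => ω ∉ E).card : ℝ) ≤ Fintype.card (Outcome d) * ε) :
    1 - ENNReal.ofReal ε ≤ outcomeLaw d E := by
  have : Nonempty (Pairing d) := nonempty_pairing h
  have hne : Nonempty (Outcome d) := inferInstanceAs (Nonempty (Pairing d × Equiv.Perm (Fin n)))
  have := isProbabilityMeasure_outcomeLaw h
  have hc : outcomeLaw d Eᶜ ≤ ENNReal.ofReal ε := by
    have hN : (0 : ℝ) < Fintype.card (Outcome d) := by exact_mod_cast Fintype.card_pos
    have hset : Eᶜ = ((Finset.univ.filter fun ω => ω ∉ E : Finset (Outcome d)) : Set _) := by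
      ext ω; simp
    rw [outcomeLaw, uniformOn_univ, hset, MeasureTheory.Measure.count_apply_finset]
    refine ENNReal.div_le_of_le_mul ?_
    rw [← ENNReal.ofReal_natCast, ← ENNReal.ofReal_natCast, mul_comm,
      ← ENNReal.ofReal_mul hN.le]
    exact ENNReal.ofReal_le_ofReal hE
  rw [← compl_compl E, MeasureTheory.prob_compl_eq_one_sub (Set.toFinite Eᶜ).measurableSet]
  exact tsub_le_tsub_left hc 1

/-! ### The limit -/

/-- A quantitative form of the theorem. With `k` vertices of positive degree and `T = ⌈√n⌉`, the
normalized second moment of the degree sum of the selected set is at most `4 / λ + T / k + 4 / T`,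
and `k ≥ δ n` unless the isolated vertices alone give the claim. The failure probability is
governed by the product of this bound with the square of `min (λ ^ (1/8)) (n ^ (1/6))`. -/
theorem one_sub_le_outcomeLaw_greedySize (h : Even (∑ i, d i)) {δ : ℝ} (hδ : 0 < δ) (hn : 0 < n)
    (hlam : 0 < avgDegree d) :
    1 - ENNReal.ofReal (2 * √(4 * avgDegree d ^ (-(3 / 4) : ℝ) +
        (2 / δ + 4) * (n : ℝ) ^ (-(1 / 6) : ℝ)) / δ +
        16 * (4 * (avgDegree d)⁻¹ + (2 / δ + 4) * (n : ℝ) ^ (-(1 / 2) : ℝ))) ≤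
      outcomeLaw d {ω | (1 - δ) * (lowDegreeCount d : ℝ) ≤ (greedySize d ω : ℝ)} := by
  classical
  have hn' : (0 : ℝ) < n := by exact_mod_cast hn
  set lam := avgDegree d with hlamdef
  set D : ℝ := min (lam ^ (1 / 8 : ℝ)) ((n : ℝ) ^ (1 / 6 : ℝ)) with hDdef
  have hD : 0 ≤ D := by positivity
  set L := Finset.univ.filter fun i => (d i : ℝ) ≤ D
  have hr : lowDegreeCount d = L.card := rfl
  refine one_sub_le_outcomeLaw h _ ?_
  -- if the isolated vertices suffice there is nothing to prove; otherwise `k ≥ δ n`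
  by_cases hz : (1 - δ) * (L.card : ℝ) ≤ (Finset.univ.filter fun i => d i = 0).card
  · have : (Finset.univ.filter fun ω : Outcome d =>
        ω ∉ {ω | (1 - δ) * (lowDegreeCount d : ℝ) ≤ (greedySize d ω : ℝ)}) = ∅ := by
      refine Finset.filter_eq_empty_iff.2 fun ω _ hω => hω ?_
      refine hz.trans ?_
      exact_mod_cast card_filter_eq_zero_le_card_chosen ω.1 ω.2
    rw [this, Finset.card_empty, Nat.cast_zero]
    positivity
  set k := (Finset.univ.filter fun w => d w ≠ 0).card with hk
  have hzk : ((Finset.univ.filter fun i => d i = 0).card : ℝ) + k = n := by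
    have := Finset.card_filter_add_card_filter_not (s := (Finset.univ : Finset (Fin n)))
      (fun i => d i = 0)
    rw [Finset.card_univ, Fintype.card_fin] at this
    exact_mod_cast this
  have hkn : δ * n ≤ k := by
    have hLn : (L.card : ℝ) ≤ n := by
      exact_mod_cast (Finset.card_le_univ L).trans (by simp)
    push Not at hz
    have hδ1 : 0 ≤ 1 - δ := by
      by_contra hneg
      have := mul_nonpos_of_nonpos_of_nonneg (not_le.1 hneg).le (Nat.cast_nonneg (α := ℝ) L.card)
      exact absurd (hz.trans_le this) (not_lt.2 (Nat.cast_nonneg _))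
    have := mul_le_mul_of_nonneg_left hLn hδ1
    linarith
  have hkpos' : (0 : ℝ) < k := lt_of_lt_of_le (by positivity) hkn
  have hkpos : 0 < k := by exact_mod_cast hkpos'
  set M := ∑ w, d w with hMdef
  have hMlam : (M : ℝ) = n * lam := by
    rw [hlamdef, avgDegree_eq, hMdef]
    push_cast
    field_simp
  have hM' : (0 : ℝ) < M := by rw [hMlam]; positivity
  have hM : 0 < M := by exact_mod_cast hM'
  -- `√n` balances the two error terms `T / k` and `4 / T`, as `k` is of order `n`
  set T := ⌈√(n : ℝ)⌉₊ with hT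
  have hs1 : 1 ≤ √(n : ℝ) := Real.one_le_sqrt.2 (by exact_mod_cast hn)
  have hTl : √(n : ℝ) ≤ T := Nat.le_ceil _
  have hTu : (T : ℝ) ≤ 2 * √(n : ℝ) := by
    have := (Nat.ceil_lt_add_one (Real.sqrt_nonneg (n : ℝ))).le
    linarith
  have hTpos : 0 < T := Nat.ceil_pos.2 (by positivity)
  have hhalf : (n : ℝ) ^ (-(1 / 2) : ℝ) = (√(n : ℝ))⁻¹ := by
    rw [Real.rpow_neg hn'.le, Real.sqrt_eq_rpow]
  set q : ℝ := 4 * lam⁻¹ + (2 / δ + 4) * (n : ℝ) ^ (-(1 / 2) : ℝ) with hqdef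
  have hq : (∑ p : Pairing d × Equiv.Perm (Fin n), (chosenDegree p : ℝ) ^ 2) ≤
      Fintype.card (Pairing d × Equiv.Perm (Fin n)) * ((M : ℝ) ^ 2 * q) := by
    refine (sum_sq_chosenDegree_le hTpos hkpos).trans ?_
    refine mul_le_mul_of_nonneg_left ?_ (Nat.cast_nonneg _)
    have h1 : (T : ℝ) / k ≤ 2 / δ * (√(n : ℝ))⁻¹ := by
      have hsq : √(n : ℝ) * √(n : ℝ) = n := Real.mul_self_sqrt hn'.le
      calc (T : ℝ) / k ≤ 2 * √(n : ℝ) / (δ * n) := by gcongr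
        _ = _ := by
          rw [← hsq]
          field_simp
          rw [Real.sqrt_sq (by positivity)]
    have h2 : 4 / (T : ℝ) ≤ 4 * (√(n : ℝ))⁻¹ := by
      rw [← div_eq_mul_inv]
      gcongr
    have h3 : (4 * n * M : ℝ) = (M : ℝ) ^ 2 * (4 * lam⁻¹) := by
      rw [hMlam]
      field_simp
    rw [h3, ← mul_add, hqdef, hhalf]
    refine mul_le_mul_of_nonneg_left ?_ (by positivity)
    linarith
  have hDq : D * √q ≤ √(4 * lam ^ (-(3 / 4) : ℝ) + (2 / δ + 4) * (n : ℝ) ^ (-(1 / 6) : ℝ)) := by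
    refine Real.le_sqrt_of_sq_le ?_
    have hq0 : 0 ≤ q := by positivity
    rw [mul_pow, Real.sq_sqrt hq0, hqdef, mul_add]
    have hD1 : D ^ 2 ≤ lam ^ (1 / 4 : ℝ) := by
      calc D ^ 2 ≤ (lam ^ (1 / 8 : ℝ)) ^ 2 := by gcongr; exact min_le_left _ _
        _ = _ := by rw [← Real.rpow_natCast, ← Real.rpow_mul hlam.le]; norm_num
    have hD2 : D ^ 2 ≤ (n : ℝ) ^ (1 / 3 : ℝ) := by
      calc D ^ 2 ≤ ((n : ℝ) ^ (1 / 6 : ℝ)) ^ 2 := by gcongr; exact min_le_right _ _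
        _ = _ := by rw [← Real.rpow_natCast, ← Real.rpow_mul hn'.le]; norm_num
    have e1 : lam ^ (1 / 4 : ℝ) * (4 * lam⁻¹) = 4 * lam ^ (-(3 / 4) : ℝ) := by
      rw [← Real.rpow_neg_one, mul_left_comm, ← Real.rpow_add hlam]
      norm_num
    have e2 : (n : ℝ) ^ (1 / 3 : ℝ) * ((2 / δ + 4) * (n : ℝ) ^ (-(1 / 2) : ℝ)) =
        (2 / δ + 4) * (n : ℝ) ^ (-(1 / 6) : ℝ) := by
      rw [mul_left_comm, ← Real.rpow_add hn']
      norm_num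
    rw [← e1, ← e2]
    gcongr
  have hmain := card_chosen_lt_le hD hδ hM hq L fun i hi => (Finset.mem_filter.1 hi).2
  refine le_trans (le_of_eq ?_) (hmain.trans ?_)
  · congr 2
    refine Finset.filter_congr fun ω _ => ?_
    change ¬ ((1 - δ) * (L.card : ℝ) ≤ ((chosen ω.1 ω.2).card : ℝ)) ↔
      ((chosen ω.1 ω.2).card : ℝ) < (1 - δ) * L.card
    exact not_le
  · change _ ≤ (Fintype.card (Pairing d × Equiv.Perm (Fin n)) : ℝ) * _
    gcongr

/-- For each `n`, `d n` is a degree sequence on `n` vertices with even sum. -/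
theorem theorem5p6 (d : ∀ n : ℕ, Fin n → ℕ)
    (heven : ∀ n : ℕ, Even (∑ i, d n i))
    (hlam : Tendsto (fun n : ℕ => avgDegree (d n)) atTop atTop) :
    ∀ δ : ℝ, 0 < δ →
      Tendsto
        (fun n : ℕ => outcomeLaw (d n)
          {ω | (1 - δ) * (lowDegreeCount (d n) : ℝ) ≤ (greedySize (d n) ω : ℝ)})
        atTop (𝓝 1) := by
  intro δ hδ
  have hrn : ∀ y : ℝ, 0 < y → Tendsto (fun n : ℕ => (n : ℝ) ^ (-y)) atTop (𝓝 0) := fun y hy =>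
    (tendsto_rpow_neg_atTop hy).comp tendsto_natCast_atTop_atTop
  have hrl : Tendsto (fun n : ℕ => avgDegree (d n) ^ (-(3 / 4) : ℝ)) atTop (𝓝 0) :=
    (tendsto_rpow_neg_atTop (by norm_num)).comp hlam
  have hil : Tendsto (fun n : ℕ => (avgDegree (d n))⁻¹) atTop (𝓝 0) :=
    tendsto_inv_atTop_zero.comp hlam
  have h1 : Tendsto (fun n : ℕ => 4 * avgDegree (d n) ^ (-(3 / 4) : ℝ) +
      (2 / δ + 4) * (n : ℝ) ^ (-(1 / 6) : ℝ)) atTop (𝓝 0) := by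
    simpa using (hrl.const_mul 4).add ((hrn (1 / 6) (by norm_num)).const_mul (2 / δ + 4))
  have h2 : Tendsto (fun n : ℕ => 4 * (avgDegree (d n))⁻¹ +
      (2 / δ + 4) * (n : ℝ) ^ (-(1 / 2) : ℝ)) atTop (𝓝 0) := by
    simpa using (hil.const_mul 4).add ((hrn (1 / 2) (by norm_num)).const_mul (2 / δ + 4))
  have h3 := ENNReal.tendsto_ofReal (((h1.sqrt.const_mul 2).div_const δ).add (h2.const_mul 16))
  have h4 := ENNReal.Tendsto.sub (tendsto_const_nhds (x := (1 : ENNReal))) h3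
    (Or.inl ENNReal.one_ne_top)
  simp only [Real.sqrt_zero, mul_zero, zero_div, add_zero, ENNReal.ofReal_zero, tsub_zero] at h4
  refine tendsto_of_tendsto_of_tendsto_of_le_of_le' h4 tendsto_const_nhds ?_ ?_
  · filter_upwards [hlam.eventually_gt_atTop 0, eventually_gt_atTop 0] with n hl hn
    exact one_sub_le_outcomeLaw_greedySize (heven n) hδ hn hl
  · refine Eventually.of_forall fun n => ?_
    have := isProbabilityMeasure_outcomeLaw (heven n)
    exact MeasureTheory.prob_le_one
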